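/- Let $\mathbb{K}$ be an algebraically closed field of characteristic zero and $n\ge 1$. Let $\bar{\mathrm U}(n)$ be the localization of $\mathbb{K}[\tilde h_1,\dots,\tilde h_n]$ at the multiplicative set generated by the elements $\tilde h_{ij}+k$, where $\tilde h_{ij}=\tilde h_i-\tilde h_j$, $i\ne j$, $k\in\mathbb{Z}$. For $f\in\bar{\mathrm U}(n)$ and $m\in\mathbb{Z}$ let $f[m\varepsilon_i]$ be the image of $f$ under the automorphism $\tilde h_j\mapsto\tilde h_j+m\,\delta_{ij}$, and put $\Delta_i f=f-f[-\varepsilon_i]$. Let $\mathcal W\subset\bar{\mathrm U}(n)$ be the $\mathbb{K}$-span of the elements $\pi(\tilde h_j)/\chi_j$, $\pi\in\mathbb{K}[t]$, $j=1,\dots,n$, where $\chi_j=\prod_{s\ne j}\tilde h_{js}$. For $\sigma\in\mathcal W$ and $\sigma_i=\Delta_i\sigma$, let $\mathrm{Diff}_{\mathbf h,\sigma}(n)$ be the $\mathbb{K}$-algebra generated by $\bar{\mathrm U}(n)$ and elements $x^i,\bar\partial_i$, $i=1,\dots,n$, with the defining relations $$\tilde h_ix^j=x^j(\tilde h_i+\delta_{ij}),\qquad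 \tilde h_i\bar\partial_j=\bar\partial_j(\tilde h_i-\delta_{ij}),$$ $$x^ix^j=\frac{\tilde h_{ij}+1}{\tilde h_{ij}}\,x^jx^i,\qquad \bar\partial_i\bar\partial_j=\frac{\tilde h_{ij}-1}{\tilde h_{ij}}\,\bar\partial_j\bar\partial_i\qquad(i<j),$$ $$x^i\bar\partial_j=\bar\partial_jx^i\ \ (i<j),\qquad x^i\bar\partial_j=\frac{\tilde h_{ij}(\tilde h_{ij}-2)}{(\tilde h_{ij}-1)^2}\,\bar\partial_jx^i\ \ (i>j),\qquad x^i\bar\partial_i=\sum_{j=1}^n\frac{1}{1-\tilde h_{ij}}\,\bar\partial_jx^j-\sigma_i .$$ Let $\vec\lambda=(\lambda_1,\dots,\lambda_n)\in\mathbb{K}^n$ satisfy $\lambda_i-\lambda_j\notin\mathbb{Z}$ for all $i\ne j$, and write $f|_{\vec\lambda}=f(\lambda_1,\dots,\lambda_n)$ for $f\in\bar{\mathrm U}(n)$. Let $W_{\vec\lambda}$ be the highest weight module, that is, the left $\mathrm{Diff}_{\mathbf h,\sigma}(n)$-module induced from the one-dimensional module $\mathbb{K}v$, $\tilde h_iv=\lambda_iv$,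 $x^iv=0$ ($i=1,\dots,n$), over the $\bar{\mathrm U}(n)$-subring generated by $x^1,\dots,x^n$; equivalently, the quotient of $\mathrm{Diff}_{\mathbf h,\sigma}(n)$ by the left ideal generated by all $\tilde h_i-\lambda_i$ and $x^i$. **Theorem.** Let $\mathcal M$ be a quotient module of $W_{\vec\lambda}$, and let $v\in\mathcal M$ denote the image of the generating vector. Assume that for each $i=1,\dots,n$ there is a largest integer $d_i\ge 0$ with $\bar\partial_i^{\,d_i}v\ne 0$ (so $\bar\partial_i^{\,d_i+1}v=0$). Then $\mathcal M$ is irreducible if and only if for every $i=1,\dots,n$ $$\bigl(\sigma-\sigma[-(d_i+1)\varepsilon_i]\bigr)\big|_{\vec\lambda}=0\qquad\text{and}\qquad\bigl(\sigma-\sigma[-k\varepsilon_i]\bigr)\big|_{\vec\lambda}\ne 0\quad\text{for all }1\le k\le d_i .$$ -/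

import Mathlib

namespace HDiff

variable {K : Type*} [Field K] {n : ℕ}

/-! ### The localized polynomial ring -/

/-- The multiplicative set of denominators: it is generated by the polynomials
`h_i - h_j + k` with `i ≠ j` and `k` an integer. -/
noncomputable def denoms (K : Type*) [Field K] (n : ℕ) : Submonoid (MvPolynomial (Fin n) K) :=
  Submonoid.closure
    {p | ∃ i j : Fin n, i ≠ j ∧ ∃ k : ℤ,
      p = MvPolynomial.X i - MvPolynomial.X j + MvPolynomial.C (k : K)}

/-- The ring `Ū(n)` of fractions of `K[h_1, …, h_n]` with denominators generated by the
`h_i - h_j + k`, `i ≠ j`, `k ∈ ℤ`. -/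
abbrev UBar (K : Type*) [Field K] (n : ℕ) : Type _ := Localization (denoms K n)

/-- The generator `h_i` of `Ū(n)`. -/
noncomputable def h (i : Fin n) : UBar K n :=
  algebraMap (MvPolynomial (Fin n) K) (UBar K n) (MvPolynomial.X i)

/-- The elements `h_i - h_j + k`, `i ≠ j`, are invertible in `Ū(n)`. -/
theorem isUnit_h_sub_h_add {i j : Fin n} (hij : i ≠ j) (k : ℤ) :
    IsUnit (h i - h j + (k : UBar K n)) := by
  have hmem : (MvPolynomial.X i - MvPolynomial.X j + MvPolynomial.C (k : K)
      : MvPolynomial (Fin n) K) ∈ denoms K n :=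
    Submonoid.subset_closure ⟨i, j, hij, k, rfl⟩
  have hu := IsLocalization.map_units (UBar K n) ⟨_, hmem⟩
  simpa [h] using hu

/-- The translation `h_i ↦ h_i + a_i` of polynomials, for an integer vector `a`. -/
noncomputable def polyShift (a : Fin n → ℤ) :
    MvPolynomial (Fin n) K →ₐ[K] MvPolynomial (Fin n) K :=
  MvPolynomial.aeval fun i => MvPolynomial.X i + MvPolynomial.C (a i : K)

theorem denoms_le_comap_polyShift (a : Fin n → ℤ) :
    denoms K n ≤ (denoms K n).comap (polyShift a : MvPolynomial (Fin n) K →ₐ[K] _) := by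
  refine Submonoid.closure_le.2 ?_
  rintro p ⟨i, j, hij, k, rfl⟩
  refine Submonoid.subset_closure ⟨i, j, hij, k + a i - a j, ?_⟩
  simp [polyShift]
  ring

/-- The translation `f ↦ f[a]`, `h_i ↦ h_i + a_i`, of `Ū(n)`, for an integer vector `a`. -/
noncomputable def shift (a : Fin n → ℤ) : UBar K n →+* UBar K n :=
  IsLocalization.map (UBar K n) (polyShift a : MvPolynomial (Fin n) K →ₐ[K] _).toRingHom
    (denoms_le_comap_polyShift a)

/-- `f[m ε_i]`: the translation `h_j ↦ h_j + m δ_{ij}` of `Ū(n)`. -/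
noncomputable def shiftAt (i : Fin n) (m : ℤ) : UBar K n →+* UBar K n :=
  shift (Pi.single i m)

theorem shift_h (a : Fin n → ℤ) (i : Fin n) :
    shift a (h i) = h i + (a i : UBar K n) := by
  simp [shift, h, polyShift]

/-- The finite difference operator `Δ_i f = f - f[-ε_i]`. -/
noncomputable def delta (i : Fin n) (f : UBar K n) : UBar K n := f - shiftAt i (-1) f

/-- The subspace `𝒲` of `Ū(n)`: the `K`-span of the elements `π(h_j) / χ_j`, where
`π ∈ K[t]` and `χ_j = ∏_{s ≠ j} (h_j - h_s)`. -/
noncomputable def potentials (K : Type*) [Field K] (n : ℕ) : Submodule K (UBar K n) :=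
  Submodule.span K
    {f | ∃ (j : Fin n) (π : Polynomial K),
      f = Polynomial.aeval (h j : UBar K n) π *
        Ring.inverse (∏ s ∈ Finset.univ.erase j, (h j - h s))}

/-! ### Evaluation at a generic point -/

/-- The weights `λ ∈ Kⁿ` with `λ_i - λ_j ∉ ℤ` for `i ≠ j`. -/
def Generic (lam : Fin n → K) : Prop :=
  ∀ i j : Fin n, i ≠ j → ∀ k : ℤ, lam i - lam j ≠ (k : K)

theorem isUnit_eval_of_mem_denoms {lam : Fin n → K} (hlam : Generic lam)
    (p : denoms K n) : IsUnit (MvPolynomial.eval lam (p : MvPolynomial (Fin n) K)) := by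
  obtain ⟨p, hp⟩ := p
  induction hp using Submonoid.closure_induction with
  | mem p hp =>
    obtain ⟨i, j, hij, k, rfl⟩ := hp
    have := hlam i j hij (-k)
    refine isUnit_iff_ne_zero.2 fun h0 => this ?_
    simp at h0
    push_cast
    linear_combination h0
  | one => simp
  | mul p q _ _ hp hq => simpa using ⟨hp.ne_zero, hq.ne_zero⟩

/-- The evaluation `f ↦ f|_λ = f(λ_1, …, λ_n)` of `f ∈ Ū(n)` at a generic point. -/
noncomputable def evalAt (lam : Fin n → K) (hlam : Generic lam) : UBar K n →+* K :=
  IsLocalization.lift (M := denoms K n) (g := MvPolynomial.eval lam)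
    (isUnit_eval_of_mem_denoms hlam)

theorem evalAt_h (lam : Fin n → K) (hlam : Generic lam) (i : Fin n) :
    evalAt lam hlam (h i) = lam i := by
  simp [evalAt, h]

/-! ### The rings of generalized `h`-deformed differential operators -/

/-- The generators: the elements of `Ū(n)`, the `x^i` and the `∂̄_i`. -/
inductive Gen (K : Type*) [Field K] (n : ℕ)
  | coeff (f : UBar K n)
  | x (i : Fin n)
  | d (i : Fin n)

/-- The generator attached to `f ∈ Ū(n)` in the free algebra. -/
noncomputable def gC (f : UBar K n) : FreeAlgebra K (Gen K n) := FreeAlgebra.ι K (Gen.coeff f)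

/-- The generator `x^i` of the free algebra. -/
noncomputable def gX (K : Type*) [Field K] {n : ℕ} (i : Fin n) : FreeAlgebra K (Gen K n) :=
  FreeAlgebra.ι K (Gen.x i)

/-- The generator `∂̄_i` of the free algebra. -/
noncomputable def gD (K : Type*) [Field K] {n : ℕ} (i : Fin n) : FreeAlgebra K (Gen K n) :=
  FreeAlgebra.ι K (Gen.d i)

/-- The defining relations of `Diff_h(σ_1, …, σ_n)`, with `h_ij = h_i - h_j`. The first three
make `Ū(n)` a subring of coefficients. The next two are the weight relations
`h_i x^j = x^j (h_i + δ_ij)` and `h_i ∂̄_j = ∂̄_j (h_i - δ_ij)`, written for all elements of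
`Ū(n)`, to which they extend from the `h_i`. All inverses below are inverses of units. -/
inductive Rel (s : Fin n → UBar K n) :
    FreeAlgebra K (Gen K n) → FreeAlgebra K (Gen K n) → Prop
  | coeff_add (f g : UBar K n) : Rel s (gC (f + g)) (gC f + gC g)
  | coeff_mul (f g : UBar K n) : Rel s (gC (f * g)) (gC f * gC g)
  | coeff_scalar (c : K) :
      Rel s (gC (algebraMap K (UBar K n) c)) (algebraMap K (FreeAlgebra K (Gen K n)) c)
  | weight_x (f : UBar K n) (j : Fin n) :
      Rel s (gC f * gX K j) (gX K j * gC (shiftAt j 1 f))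
  | weight_d (f : UBar K n) (j : Fin n) :
      Rel s (gC f * gD K j) (gD K j * gC (shiftAt j (-1) f))
  | x_x (i j : Fin n) (hij : i < j) :
      Rel s (gX K i * gX K j)
        (gC ((h i - h j + 1) * Ring.inverse (h i - h j)) * (gX K j * gX K i))
  | d_d (i j : Fin n) (hij : i < j) :
      Rel s (gD K i * gD K j)
        (gC ((h i - h j - 1) * Ring.inverse (h i - h j)) * (gD K j * gD K i))
  | x_d_lt (i j : Fin n) (hij : i < j) :
      Rel s (gX K i * gD K j) (gD K j * gX K i)
  | x_d_gt (i j : Fin n) (hij : j < i) :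
      Rel s (gX K i * gD K j)
        (gC ((h i - h j) * (h i - h j - 2) * Ring.inverse ((h i - h j - 1) ^ 2)) *
          (gD K j * gX K i))
  | x_d_eq (i : Fin n) :
      Rel s (gX K i * gD K i)
        (∑ j, gC (Ring.inverse (1 - (h i - h j))) * (gD K j * gX K j) - gC (s i))

/-- The ring `Diff_{h,σ}(n) = Diff_h(Δ_1 σ, …, Δ_n σ)` with potential `σ`. -/
def Diff (σ : UBar K n) : Type _ := RingQuot (Rel fun i => delta i σ)

noncomputable instance (σ : UBar K n) : Ring (Diff σ) :=
  inferInstanceAs (Ring (RingQuot (Rel fun i => delta i σ)))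

noncomputable instance (σ : UBar K n) : Algebra K (Diff σ) :=
  inferInstanceAs (Algebra K (RingQuot (Rel fun i => delta i σ)))

/-- The canonical map from the free algebra onto `Diff_{h,σ}(n)`. -/
noncomputable def toDiff (σ : UBar K n) : FreeAlgebra K (Gen K n) →ₐ[K] Diff σ :=
  RingQuot.mkAlgHom K (Rel fun i => delta i σ)

/-- The image of `f ∈ Ū(n)` in `Diff_{h,σ}(n)`. -/
noncomputable def coeff (σ : UBar K n) (f : UBar K n) : Diff σ := toDiff σ (gC f)

/-- The element `x^i` of `Diff_{h,σ}(n)`. -/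
noncomputable def x (σ : UBar K n) (i : Fin n) : Diff σ := toDiff σ (gX K i)

/-- The element `∂̄_i` of `Diff_{h,σ}(n)`. -/
noncomputable def d (σ : UBar K n) (i : Fin n) : Diff σ := toDiff σ (gD K i)

/-! ### Highest weight modules -/

/-- The left ideal of `Diff_{h,σ}(n)` generated by the `h_i - λ_i` and the `x^i`. -/
noncomputable def weightIdeal (σ : UBar K n) (lam : Fin n → K) :
    Submodule (Diff σ) (Diff σ) :=
  Submodule.span (Diff σ)
    (Set.range (fun i => coeff σ (h i) - algebraMap K (Diff σ) (lam i)) ∪ Set.range (x σ))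

/-- The highest weight module `W_λ`: the left `Diff_{h,σ}(n)`-module induced from the
one-dimensional module `K v`, `h_i v = λ_i v`, `x^i v = 0`, over the `Ū(n)`-subring generated
by the `x^i`. Since the annihilator of `v` in that subring is generated by the `h_i - λ_i` and
the `x^i`, the induced module is `Diff_{h,σ}(n)` modulo the left ideal they generate. -/
abbrev HWModule (σ : UBar K n) (lam : Fin n → K) : Type _ := Diff σ ⧸ weightIdeal σ lam

/-- The generating highest weight vector of `W_λ`. -/
noncomputable def hwVector (σ : UBar K n) (lam : Fin n → K) : HWModule σ lam :=
  Submodule.Quotient.mk 1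

end HDiff

/-! On weight vectors every coefficient in a defining relation becomes a scalar, and units of `UBar
K n` become nonzero scalars because `lam` is generic. Up to nonzero scalars the `d σ i` therefore
commute with each other, and `x σ i` commutes with `d σ j` for `i ≠ j`. The remaining relation
telescopes: `x σ i` sends `d σ i ^ k • v` to minus the value at `lam` of `σ - σ[-k ε_i]`, times `d σ
i ^ (k - 1) • v` (`x_smul_d_pow_smul`).

So the module is spanned by monomial vectors indexed by multisets; raising adds an element, and
lowering removes one with a factor that vanishes only with such a value
(`exists_x_smul_monomialVec`). In characteristic zero different multisets have different weights, so
every submodule contains the weight components of its elements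
(`monomialVec_mem_of_linearCombination_mem`).

The vanishing at `dM i + 1` is automatic. A zero value at some `1 ≤ k ≤ dM i` makes the monomials
with at least `k` factors `d σ i` span a proper nonzero submodule. If there is no such zero, any
nonzero monomial vector can be lowered to `v`. -/

namespace HDiff

/-! ### Shifts and evaluations of coefficients -/

section Coefficients

variable {K : Type*} [Field K] {n : ℕ}

theorem shift_algebraMap (a : Fin n → ℤ) (p : MvPolynomial (Fin n) K) :
    shift a (algebraMap _ (UBar K n) p) = algebraMap _ (UBar K n) (polyShift a p) := by
  simp [shift]

theorem polyShift_polyShift (a b : Fin n → ℤ) (p : MvPolynomial (Fin n) K) :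
    polyShift a (polyShift b p) = polyShift (a + b) p := by
  have : (polyShift a).comp (polyShift b) = polyShift (K := K) (a + b) := by
    ext i : 1
    simp [polyShift, add_assoc]
  exact DFunLike.congr_fun this p

theorem shift_shift (a b : Fin n → ℤ) (f : UBar K n) :
    shift a (shift b f) = shift (a + b) f := by
  have : (shift a).comp (shift b) = shift (K := K) (a + b) := by
    refine IsLocalization.ringHom_ext (denoms K n) (RingHom.ext fun p => ?_)
    simp only [RingHom.comp_apply, shift_algebraMap, polyShift_polyShift]
  exact DFunLike.congr_fun this f

theorem shift_zero (f : UBar K n) : shift 0 f = f := by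
  have : shift 0 = RingHom.id (UBar K n) := by
    refine IsLocalization.ringHom_ext (denoms K n) (RingHom.ext fun p => ?_)
    have h0 : polyShift 0 = AlgHom.id K (MvPolynomial (Fin n) K) := by
      ext i : 1
      simp [polyShift]
    simp only [RingHom.comp_apply, shift_algebraMap, h0, AlgHom.id_apply, RingHom.id_apply]
  exact DFunLike.congr_fun this f

theorem shift_algebraMap_scalar (a : Fin n → ℤ) (c : K) :
    shift a (algebraMap K (UBar K n) c) = algebraMap K (UBar K n) c := by
  rw [IsScalarTower.algebraMap_apply K (MvPolynomial (Fin n) K) (UBar K n), shift_algebraMap,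
    MvPolynomial.algebraMap_eq, polyShift, MvPolynomial.aeval_C, MvPolynomial.algebraMap_eq]

theorem evalAt_algebraMap (lam : Fin n → K) (hlam : Generic lam)
    (p : MvPolynomial (Fin n) K) :
    evalAt lam hlam (algebraMap _ (UBar K n) p) = MvPolynomial.eval lam p := by
  simp [evalAt]

theorem evalAt_algebraMap_scalar (lam : Fin n → K) (hlam : Generic lam) (c : K) :
    evalAt lam hlam (algebraMap K (UBar K n) c) = c := by
  rw [IsScalarTower.algebraMap_apply K (MvPolynomial (Fin n) K) (UBar K n), evalAt_algebraMap]
  simp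

theorem isUnit_h_sub_h {i j : Fin n} (hij : i ≠ j) : IsUnit (h i - h j : UBar K n) := by
  simpa using isUnit_h_sub_h_add (K := K) hij 0

theorem isUnit_h_sub_h_sub {i j : Fin n} (hij : i ≠ j) (k : ℕ) :
    IsUnit (h i - h j - (k : UBar K n)) := by
  simpa [sub_eq_add_neg] using isUnit_h_sub_h_add (K := K) hij (-(k : ℤ))

/-- The value `f(λ + a)` as a ring homomorphism on `Ū(n)`. -/
noncomputable def evalShift (lam : Fin n → K) (hlam : Generic lam) (a : Fin n → ℤ) :
    UBar K n →+* K :=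
  (evalAt lam hlam).comp (shift a)

theorem evalShift_apply (lam : Fin n → K) (hlam : Generic lam) (a : Fin n → ℤ) (f : UBar K n) :
    evalShift lam hlam a f = evalAt lam hlam (shift a f) := rfl

theorem evalShift_shiftAt (lam : Fin n → K) (hlam : Generic lam) (a : Fin n → ℤ) (j : Fin n)
    (m : ℤ) (f : UBar K n) :
    evalShift lam hlam a (shiftAt j m f) = evalShift lam hlam (a + Pi.single j m) f := by
  simp only [evalShift_apply, shiftAt, shift_shift]

theorem evalShift_h (lam : Fin n → K) (hlam : Generic lam) (a : Fin n → ℤ) (i : Fin n) :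
    evalShift lam hlam a (h i) = lam i + a i := by
  simp [evalShift_apply, shift_h, evalAt_h]

theorem evalShift_scalar (lam : Fin n → K) (hlam : Generic lam) (a : Fin n → ℤ) (c : K) :
    evalShift lam hlam a (algebraMap K _ c) = c := by
  rw [evalShift_apply, shift_algebraMap_scalar, evalAt_algebraMap_scalar]

end Coefficients

/-! ### The defining relations inside the algebra -/

section Relations

variable {K : Type*} [Field K] {n : ℕ} (σ : UBar K n)

theorem toDiff_eq {a b : FreeAlgebra K (Gen K n)} (hab : Rel (fun i => delta i σ) a b) :
    toDiff σ a = toDiff σ b :=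
  RingQuot.mkAlgHom_rel K hab

/-- The map `Ū(n) → Diff_{h,σ}(n)` as a ring homomorphism. -/
noncomputable def coeffHom : UBar K n →+* Diff σ where
  toFun := coeff σ
  map_one' := by
    have := toDiff_eq σ (.coeff_scalar 1)
    simpa [coeff] using this
  map_mul' f g := by simpa [coeff] using toDiff_eq σ (.coeff_mul f g)
  map_zero' := by
    have := toDiff_eq σ (.coeff_scalar 0)
    simpa [coeff] using this
  map_add' f g := by simpa [coeff] using toDiff_eq σ (.coeff_add f g)

theorem coeff_add (f g : UBar K n) : coeff σ (f + g) = coeff σ f + coeff σ g :=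
  (coeffHom σ).map_add f g

theorem coeff_mul (f g : UBar K n) : coeff σ (f * g) = coeff σ f * coeff σ g :=
  (coeffHom σ).map_mul f g

theorem coeff_scalar (c : K) :
    coeff σ (algebraMap K _ c) = algebraMap K (Diff σ) c := by
  simpa [coeff] using toDiff_eq σ (.coeff_scalar c)

theorem coeff_mul_x (f : UBar K n) (j : Fin n) :
    coeff σ f * x σ j = x σ j * coeff σ (shiftAt j 1 f) := by
  simpa [coeff, x] using toDiff_eq σ (.weight_x f j)

theorem coeff_mul_d (f : UBar K n) (j : Fin n) :
    coeff σ f * d σ j = d σ j * coeff σ (shiftAt j (-1) f) := by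
  simpa [coeff, d] using toDiff_eq σ (.weight_d f j)

/-- The exact coefficient never matters later, only that it is a unit and so has nonzero value at
every point of `lam + ℤⁿ`. -/
theorem exists_isUnit_d_mul_d {i j : Fin n} (hij : i < j) :
    ∃ f : UBar K n, IsUnit f ∧ d σ i * d σ j = coeff σ f * (d σ j * d σ i) := by
  refine ⟨_, ?_, by simpa [coeff, d] using toDiff_eq σ (.d_d i j hij)⟩
  exact (by simpa using isUnit_h_sub_h_sub (K := K) hij.ne 1 : IsUnit (h i - h j - 1)).mul
    (isUnit_h_sub_h hij.ne).ringInverse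

theorem exists_isUnit_x_mul_d {i j : Fin n} (hij : i ≠ j) :
    ∃ f : UBar K n, IsUnit f ∧ x σ i * d σ j = coeff σ f * (d σ j * x σ i) := by
  rcases hij.lt_or_gt with hlt | hgt
  · refine ⟨1, isUnit_one, ?_⟩
    have h1 : coeff σ 1 = 1 := (coeffHom σ).map_one
    simpa [x, d, h1] using toDiff_eq σ (.x_d_lt i j hlt)
  · refine ⟨_, ?_, by simpa [coeff, x, d] using toDiff_eq σ (.x_d_gt i j hgt)⟩
    have h1 : IsUnit (h i - h j - 1 : UBar K n) := by
      simpa using isUnit_h_sub_h_sub (K := K) hij 1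
    have h2 : IsUnit (h i - h j - 2 : UBar K n) := by
      simpa using isUnit_h_sub_h_sub (K := K) hij 2
    exact ((isUnit_h_sub_h hij).mul h2).mul (h1.pow 2).ringInverse

theorem x_mul_d_self (i : Fin n) :
    x σ i * d σ i =
      ∑ j, coeff σ (Ring.inverse (1 - (h i - h j))) * (d σ j * x σ j) - coeff σ (delta i σ) := by
  simpa [coeff, x, d] using toDiff_eq σ (.x_d_eq i)

end Relations

/-! ### Weight vectors and commutation up to nonzero scalars -/

section Weights

variable {K : Type*} [Field K] {n : ℕ} {σ : UBar K n} {lam : Fin n → K} (hlam : Generic lam)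
  {M : Type*} [AddCommGroup M] [Module (Diff σ) M] [Module K M] [IsScalarTower K (Diff σ) M]

/-- The vector `u` has weight `λ + a`. -/
def HasWeight (hlam : Generic lam) (a : Fin n → ℤ) (u : M) : Prop :=
  ∀ f : UBar K n, coeff σ f • u = evalShift lam hlam a f • u

variable {hlam}

theorem HasWeight.d_smul {a : Fin n → ℤ} {u : M} (hu : HasWeight (σ := σ) hlam a u) (j : Fin n) :
    HasWeight (σ := σ) hlam (a + Pi.single j (-1)) (d σ j • u) := fun f => by
  rw [← mul_smul, coeff_mul_d, mul_smul, hu, evalShift_shiftAt, smul_comm]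

theorem HasWeight.x_smul {a : Fin n → ℤ} {u : M} (hu : HasWeight (σ := σ) hlam a u) (j : Fin n) :
    HasWeight (σ := σ) hlam (a + Pi.single j 1) (x σ j • u) := fun f => by
  rw [← mul_smul, coeff_mul_x, mul_smul, hu, evalShift_shiftAt, smul_comm]

theorem HasWeight.exists_d_smul_d_smul {a : Fin n → ℤ} {u : M}
    (hu : HasWeight (σ := σ) hlam a u) (i j : Fin n) :
    ∃ c : K, c ≠ 0 ∧ d σ i • d σ j • u = c • d σ j • d σ i • u := by
  have key : ∀ i j : Fin n, i < j →
      ∃ c : K, c ≠ 0 ∧ d σ i • d σ j • u = c • d σ j • d σ i • u := fun i j hij => by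
    obtain ⟨f, hf, e⟩ := exists_isUnit_d_mul_d σ hij
    refine ⟨_, (hf.map (evalShift lam hlam (a + Pi.single i (-1) + Pi.single j (-1)))).ne_zero, ?_⟩
    rw [← mul_smul, e, mul_smul, mul_smul, (hu.d_smul i).d_smul j f]
  rcases lt_trichotomy i j with hij | rfl | hij
  · exact key i j hij
  · exact ⟨1, one_ne_zero, (one_smul _ _).symm⟩
  · obtain ⟨c, hc, e⟩ := key j i hij
    exact ⟨c⁻¹, inv_ne_zero hc, by rw [e, inv_smul_smul₀ hc]⟩

theorem HasWeight.exists_x_smul_d_smul {a : Fin n → ℤ} {u : M}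
    (hu : HasWeight (σ := σ) hlam a u) {i j : Fin n} (hij : i ≠ j) :
    ∃ c : K, c ≠ 0 ∧ x σ i • d σ j • u = c • d σ j • x σ i • u := by
  obtain ⟨f, hf, e⟩ := exists_isUnit_x_mul_d σ hij
  refine ⟨_, (hf.map (evalShift lam hlam (a + Pi.single i 1 + Pi.single j (-1)))).ne_zero, ?_⟩
  rw [← mul_smul, e, mul_smul, mul_smul, (hu.x_smul i).d_smul j f]

/-- A vector which is an eigenvector of all `h_i` is an eigenvector of all of `Ū(n)`. -/
theorem hasWeight_zero_of_h_smul {v : M} (hv : ∀ i, coeff σ (h i) • v = lam i • v) :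
    HasWeight (σ := σ) hlam 0 v := by
  have hpoly : ∀ p : MvPolynomial (Fin n) K,
      coeff σ (algebraMap _ _ p) • v = MvPolynomial.eval lam p • v := fun p => by
    induction p using MvPolynomial.induction_on with
    | C c =>
      have : algebraMap (MvPolynomial (Fin n) K) (UBar K n) (MvPolynomial.C c) =
          algebraMap K _ c :=
        (IsScalarTower.algebraMap_apply K (MvPolynomial (Fin n) K) (UBar K n) c).symm
      rw [this, coeff_scalar, algebraMap_smul, MvPolynomial.eval_C]
    | add p q hp hq => rw [map_add, coeff_add, add_smul, hp, hq, map_add, add_smul]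
    | mul_X p i hp =>
      rw [map_mul, coeff_mul, mul_smul, ← h, hv, smul_comm, hp, map_mul, MvPolynomial.eval_X,
        mul_comm, mul_smul]
  intro f
  obtain ⟨p, q, rfl⟩ := IsLocalization.exists_mk'_eq (denoms K n) f
  rw [evalShift_apply, shift_zero]
  set f := IsLocalization.mk' (UBar K n) p q with hf
  -- With `f = p / q`, both the action on `v` and evaluation at `lam` are determined by `f * q = p`,
  -- since `q` has nonzero value there.
  have hpq : f * algebraMap _ (UBar K n) (q : MvPolynomial (Fin n) K) = algebraMap _ _ p :=
    IsLocalization.mk'_spec _ p q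
  have hq := (isUnit_eval_of_mem_denoms hlam q).ne_zero
  have h1 := congrArg (evalAt lam hlam) hpq
  rw [map_mul, evalAt_algebraMap, evalAt_algebraMap] at h1
  have h2 := congrArg (fun g => coeff σ g • v) hpq
  simp only [coeff_mul, mul_smul, hpoly] at h2
  rw [smul_comm, ← h1, mul_comm, mul_smul] at h2
  exact smul_right_injective M hq h2

/-- A subspace stable under the generators is stable under `Diff_{h,σ}(n)`. -/
theorem smul_mem_of_generators (S : Submodule K M)
    (hc : ∀ f, ∀ u ∈ S, coeff σ f • u ∈ S) (hx : ∀ i, ∀ u ∈ S, x σ i • u ∈ S)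
    (hd : ∀ i, ∀ u ∈ S, d σ i • u ∈ S) (a : Diff σ) {u : M} (hu : u ∈ S) : a • u ∈ S := by
  obtain ⟨b, rfl⟩ := RingQuot.mkAlgHom_surjective K (Rel fun i => delta i σ) a
  change toDiff σ b • u ∈ S
  induction b using FreeAlgebra.induction generalizing u with
  | grade0 r => rw [AlgHom.commutes, algebraMap_smul]; exact S.smul_mem r hu
  | grade1 g =>
    cases g with
    | coeff f => exact hc f u hu
    | x i => exact hx i u hu
    | d i => exact hd i u hu
  | mul b c hb hc => rw [map_mul, mul_smul]; exact hb (hc hu)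
  | add b c hb hc => rw [map_add, add_smul]; exact S.add_mem (hb hu) (hc hu)

/-- The product of the `∂̄_i` over a list. -/
noncomputable def dProd (σ : UBar K n) (l : List (Fin n)) : Diff σ := (l.map (d σ)).prod

@[simp] theorem dProd_nil : dProd σ [] = 1 := rfl

@[simp] theorem dProd_cons (i : Fin n) (l : List (Fin n)) :
    dProd σ (i :: l) = d σ i * dProd σ l := rfl

theorem dProd_append (l l' : List (Fin n)) : dProd σ (l ++ l') = dProd σ l * dProd σ l' := by
  simp [dProd]

theorem dProd_replicate (k : ℕ) (i : Fin n) : dProd σ (List.replicate k i) = d σ i ^ k := by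
  simp [dProd]

theorem HasWeight.dProd_smul {a : Fin n → ℤ} {u : M} (hu : HasWeight (σ := σ) hlam a u)
    (l : List (Fin n)) :
    HasWeight (σ := σ) hlam (fun i => a i - l.count i) (dProd σ l • u) := by
  induction l with
  | nil => simpa using hu
  | cons j l ih =>
    have := ih.d_smul j
    rw [dProd_cons, mul_smul]
    convert this using 1
    funext i
    rcases eq_or_ne j i with rfl | hij
    · simp; ring
    · simp [hij]

theorem HasWeight.exists_dProd_smul_of_perm {a : Fin n → ℤ} {u : M}
    (hu : HasWeight (σ := σ) hlam a u) {l l' : List (Fin n)} (hl : l.Perm l') :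
    ∃ c : K, c ≠ 0 ∧ dProd σ l • u = c • dProd σ l' • u := by
  induction hl with
  | nil => exact ⟨1, one_ne_zero, (one_smul _ _).symm⟩
  | cons i _ ih =>
    obtain ⟨c, hc, e⟩ := ih
    exact ⟨c, hc, by rw [dProd_cons, dProd_cons, mul_smul, mul_smul, e, smul_comm]⟩
  | swap i j l =>
    obtain ⟨c, hc, e⟩ := (hu.dProd_smul l).exists_d_smul_d_smul j i
    exact ⟨c, hc, by simpa [mul_smul] using e⟩
  | trans _ _ ih ih' =>
    obtain ⟨c, hc, e⟩ := ih
    obtain ⟨c', hc', e'⟩ := ih'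
    exact ⟨c * c', mul_ne_zero hc hc', by rw [e, e', mul_smul]⟩

theorem HasWeight.exists_x_smul_dProd_smul {a : Fin n → ℤ} {u : M}
    (hu : HasWeight (σ := σ) hlam a u) {i : Fin n} {l : List (Fin n)} (hi : i ∉ l) :
    ∃ c : K, c ≠ 0 ∧ x σ i • dProd σ l • u = c • dProd σ l • x σ i • u := by
  induction l with
  | nil => exact ⟨1, one_ne_zero, by simp⟩
  | cons j l ih =>
    rw [List.mem_cons, not_or] at hi
    obtain ⟨c, hc, e⟩ := ih hi.2
    obtain ⟨c', hc', e'⟩ := (hu.dProd_smul l).exists_x_smul_d_smul hi.1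
    exact ⟨c' * c, mul_ne_zero hc' hc, by
      rw [dProd_cons, mul_smul, e', e, mul_smul, mul_smul, smul_comm (d σ j) c]⟩

end Weights

/-! ### The action on powers of one lowering of the weight -/

section HighestWeight

variable {K : Type*} [Field K] {n : ℕ} {σ : UBar K n} {lam : Fin n → K} {hlam : Generic lam}
  {M : Type*} [AddCommGroup M] [Module (Diff σ) M] [Module K M] [IsScalarTower K (Diff σ) M]
  {v : M}

/-- The action of `x^i` on the powers of `∂̄_i` applied to a highest weight vector. -/
theorem x_smul_d_pow_smul (hv : HasWeight (σ := σ) hlam 0 v) (hx : ∀ i, x σ i • v = 0)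
    (i : Fin n) (k : ℕ) :
    x σ i • d σ i ^ k • v =
      -evalAt lam hlam (σ - shiftAt i (-(k : ℤ)) σ) • d σ i ^ (k - 1) • v := by
  induction k with
  | zero =>
    have : shiftAt i 0 σ = σ := by rw [shiftAt, Pi.single_zero, shift_zero]
    simp [hx, this]
  | succ k ih =>
    have hw := hv.dProd_smul (List.replicate k i)
    rw [dProd_replicate] at hw
    set u := d σ i ^ k • v with hu
    have hself : d σ i • x σ i • u =
        -evalAt lam hlam (σ - shiftAt i (-(k : ℤ)) σ) • u := by
      -- For `k = 0` the exponent `k - 1` is truncated, but both sides vanish since `σ - σ[0] = 0`.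
      cases k with
      | zero =>
        have : shiftAt i 0 σ = σ := by rw [shiftAt, Pi.single_zero, shift_zero]
        simp [hu, hx, this]
      | succ k =>
        rw [ih, smul_comm, hu, ← mul_smul, Nat.add_sub_cancel, ← pow_succ']
    have hother : ∀ j, j ≠ i → x σ j • u = 0 := fun j hj => by
      obtain ⟨c, -, e⟩ := hv.exists_x_smul_dProd_smul (i := j) (l := List.replicate k i)
        (fun hm => hj (List.eq_of_mem_replicate hm))
      rw [hu, ← dProd_replicate, e, hx, smul_zero, smul_zero]
    have ha : (fun j => (0 : Fin n → ℤ) j - ((List.replicate k i).count j : ℤ)) =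
        Pi.single i (-(k : ℤ)) := by
      funext j
      rcases eq_or_ne i j with rfl | hij
      · simp
      · simp [List.count_replicate, hij]
    have hs : (Pi.single i (-(k : ℤ)) + Pi.single i (-1) : Fin n → ℤ) =
        Pi.single i (-((k + 1 : ℕ) : ℤ)) := by
      rw [← Pi.single_add, Nat.cast_succ, neg_add]
    -- The telescoping term: `u` has weight `lam - k ε_i`, so `Δ_i σ` acts on it by the difference
    -- of two consecutive shifts of `σ`.
    have hdelta : coeff σ (delta i σ) • u =
        (evalAt lam hlam (shiftAt i (-(k : ℤ)) σ) -
          evalAt lam hlam (shiftAt i (-((k + 1 : ℕ) : ℤ)) σ)) • u := by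
      rw [hw, ha, delta, map_sub, evalShift_shiftAt, hs, evalShift_apply, evalShift_apply, shiftAt,
        shiftAt]
    -- Only the summand `j = i` survives, with coefficient `1 / (1 - 0) = 1`.
    rw [pow_succ', mul_smul, ← hu, ← mul_smul, x_mul_d_self, sub_smul, Finset.sum_smul,
      Finset.sum_eq_single i, hdelta, Nat.add_sub_cancel, ← hu]
    · have h1 : coeff σ 1 = 1 := (coeffHom σ).map_one
      rw [sub_self, sub_zero, Ring.inverse_one, h1, one_mul, mul_smul, hself, ← sub_smul]
      congr 1
      simp only [map_sub]
      ring
    · intro j _ hj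
      rw [mul_smul, mul_smul, hother j hj, smul_zero, smul_zero]
    · simp

/-! ### Monomial vectors indexed by multisets -/

variable (σ v) in
/-- The monomial in the `∂̄_i` with exponents given by a multiset, applied to `v`. -/
noncomputable def monomialVec (m : Multiset (Fin n)) : M :=
  dProd σ m.toList • v

theorem monomialVec_zero : monomialVec σ v 0 = v := by simp [monomialVec]

theorem coeff_smul_monomialVec (hv : HasWeight (σ := σ) hlam 0 v) (m : Multiset (Fin n))
    (f : UBar K n) :
    coeff σ f • monomialVec σ v m =
      evalShift lam hlam (fun i => -(m.count i : ℤ)) f • monomialVec σ v m := by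
  have := hv.dProd_smul m.toList f
  rw [monomialVec, this]
  congr 3
  funext i
  rw [Pi.zero_apply, zero_sub, ← Multiset.coe_count, Multiset.coe_toList]

theorem exists_d_smul_monomialVec (hv : HasWeight (σ := σ) hlam 0 v) (i : Fin n)
    (m : Multiset (Fin n)) :
    ∃ c : K, c ≠ 0 ∧ d σ i • monomialVec σ v m = c • monomialVec σ v (i ::ₘ m) := by
  rw [monomialVec, ← mul_smul, ← dProd_cons]
  refine hv.exists_dProd_smul_of_perm ?_
  rw [← Multiset.coe_eq_coe, ← Multiset.cons_coe, Multiset.coe_toList, Multiset.coe_toList]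

/-- Gathers all factors `d σ i` next to `v`. Keeping `m'` separate from `m` lets `m` and `m.erase i`
share the same left factor. -/
theorem exists_monomialVec_eq (hv : HasWeight (σ := σ) hlam 0 v) (i : Fin n)
    (m : Multiset (Fin n)) (k : ℕ) {m' : Multiset (Fin n)}
    (hm : m' = m.filter (· ≠ i) + Multiset.replicate k i) :
    ∃ c : K, c ≠ 0 ∧ monomialVec σ v m' =
      c • dProd σ (m.filter (· ≠ i)).toList • d σ i ^ k • v := by
  rw [← dProd_replicate, ← mul_smul, ← dProd_append, monomialVec]
  refine hv.exists_dProd_smul_of_perm ?_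
  rw [← Multiset.coe_eq_coe, ← Multiset.coe_add, Multiset.coe_toList, Multiset.coe_toList, hm,
    Multiset.coe_replicate]

theorem filter_ne_add_replicate (i : Fin n) (m : Multiset (Fin n)) :
    m = m.filter (· ≠ i) + Multiset.replicate (m.count i) i := by
  ext j
  rcases eq_or_ne j i with rfl | hj
  · simp
  · simp [hj, Multiset.count_replicate, hj.symm]

theorem erase_eq_filter_ne_add_replicate (i : Fin n) (m : Multiset (Fin n)) :
    m.erase i = m.filter (· ≠ i) + Multiset.replicate (m.count i - 1) i := by
  ext j
  rcases eq_or_ne j i with rfl | hj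
  · simp
  · simp [hj, Multiset.count_replicate, hj.symm]

/-- Move `x σ i` past the factors with other indices, then apply the one-variable formula to the
power of `d σ i` at `v`. -/
theorem exists_x_smul_monomialVec (hv : HasWeight (σ := σ) hlam 0 v) (hx : ∀ i, x σ i • v = 0)
    (i : Fin n) (m : Multiset (Fin n)) :
    ∃ c : K, c ≠ 0 ∧ x σ i • monomialVec σ v m =
      (c * evalAt lam hlam (σ - shiftAt i (-(m.count i : ℤ)) σ)) •
        monomialVec σ v (m.erase i) := by
  obtain ⟨c, hc, e⟩ := exists_monomialVec_eq hv i m _ (filter_ne_add_replicate i m)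
  obtain ⟨c', hc', e'⟩ := exists_monomialVec_eq hv i m _ (erase_eq_filter_ne_add_replicate i m)
  have hw := hv.dProd_smul (List.replicate (m.count i) i)
  rw [dProd_replicate] at hw
  obtain ⟨b, hb, eb⟩ := hw.exists_x_smul_dProd_smul (i := i) (l := (m.filter (· ≠ i)).toList)
    (by simp)
  refine ⟨-(c * b * c'⁻¹), by simp [hc, hb, hc'], ?_⟩
  rw [e, smul_comm, eb, x_smul_d_pow_smul hv hx, smul_comm (dProd σ _), e']
  generalize dProd σ _ • d σ i ^ (m.count i - 1) • v = w
  simp only [smul_smul]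
  congr 1
  field_simp

theorem monomialVec_eq_zero (hv : HasWeight (σ := σ) hlam 0 v) {i : Fin n}
    {m : Multiset (Fin n)} (hm : d σ i ^ m.count i • v = 0) : monomialVec σ v m = 0 := by
  obtain ⟨c, -, e⟩ := exists_monomialVec_eq hv i m _ (filter_ne_add_replicate i m)
  rw [e, hm, smul_zero, smul_zero]

/-- The span of a family of monomial vectors stable under raising, and under those lowerings
which do not vanish, as a submodule over `Diff_{h,σ}(n)`. -/
noncomputable def monomialSpan (hv : HasWeight (σ := σ) hlam 0 v) (hx : ∀ i, x σ i • v = 0)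
    (P : Set (Multiset (Fin n))) (hcons : ∀ i, ∀ m ∈ P, i ::ₘ m ∈ P)
    (herase : ∀ i, ∀ m ∈ P, evalAt lam hlam (σ - shiftAt i (-(m.count i : ℤ)) σ) ≠ 0 →
      m.erase i ∈ P) : Submodule (Diff σ) M where
  carrier := Submodule.span K (monomialVec σ v '' P)
  add_mem' := Submodule.add_mem _
  zero_mem' := Submodule.zero_mem _
  smul_mem' a u hu := by
    have key : ∀ b : Diff σ,
        (∀ m ∈ P, b • monomialVec σ v m ∈ Submodule.span K (monomialVec σ v '' P)) →
        ∀ u ∈ Submodule.span K (monomialVec σ v '' P),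
          b • u ∈ Submodule.span K (monomialVec σ v '' P) := fun b hb u hu => by
      induction hu using Submodule.span_induction with
      | mem u hu => obtain ⟨m, hm, rfl⟩ := hu; exact hb m hm
      | zero => rw [smul_zero]; exact Submodule.zero_mem _
      | add u w _ _ h1 h2 => rw [smul_add]; exact Submodule.add_mem _ h1 h2
      | smul c u _ h1 => rw [smul_comm]; exact Submodule.smul_mem _ c h1
    refine smul_mem_of_generators _ (fun f => key _ fun m hm => ?_) (fun i => key _ fun m hm => ?_)
      (fun i => key _ fun m hm => ?_) a hu
    · rw [coeff_smul_monomialVec hv]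
      exact Submodule.smul_mem _ _ (Submodule.subset_span ⟨m, hm, rfl⟩)
    · obtain ⟨c, -, e⟩ := exists_x_smul_monomialVec hv hx i m
      rw [e]
      by_cases h0 : evalAt lam hlam (σ - shiftAt i (-(m.count i : ℤ)) σ) = 0
      · rw [h0, mul_zero, zero_smul]
        exact Submodule.zero_mem _
      · exact Submodule.smul_mem _ _ (Submodule.subset_span ⟨_, herase i m hm h0, rfl⟩)
    · obtain ⟨c, -, e⟩ := exists_d_smul_monomialVec hv i m
      rw [e]
      exact Submodule.smul_mem _ _ (Submodule.subset_span ⟨_, hcons i m hm, rfl⟩)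

theorem mem_monomialSpan {hv : HasWeight (σ := σ) hlam 0 v} {hx : ∀ i, x σ i • v = 0}
    {P : Set (Multiset (Fin n))} {hcons herase} {u : M} :
    u ∈ monomialSpan hv hx P hcons herase ↔ u ∈ Submodule.span K (monomialVec σ v '' P) :=
  Iff.rfl

theorem span_range_monomialVec (hv : HasWeight (σ := σ) hlam 0 v) (hx : ∀ i, x σ i • v = 0)
    (hgen : Submodule.span (Diff σ) {v} = ⊤) :
    Submodule.span K (Set.range (monomialVec σ v)) = ⊤ := by
  let N := monomialSpan hv hx Set.univ (fun _ _ _ => trivial) (fun _ _ _ _ => trivial)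
  have hN : N = ⊤ := by
    rw [eq_top_iff, ← hgen, Submodule.span_singleton_le_iff_mem]
    exact mem_monomialSpan.2 (Submodule.subset_span ⟨0, trivial, monomialVec_zero⟩)
  refine eq_top_iff.2 fun u _ => ?_
  have hu : u ∈ N := hN ▸ Submodule.mem_top
  rw [← Set.image_univ]
  exact mem_monomialSpan.1 hu

/-- A submodule contains the weight components of its elements. -/
theorem monomialVec_mem_of_linearCombination_mem [CharZero K] (hv : HasWeight (σ := σ) hlam 0 v)
    (N : Submodule (Diff σ) M) (l : Multiset (Fin n) →₀ K)
    (hN : Finsupp.linearCombination K (monomialVec σ v) l ∈ N) {m₀ : Multiset (Fin n)}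
    (hl : l m₀ ≠ 0) : monomialVec σ v m₀ ∈ N := by
  have hsep : ∀ m : Multiset (Fin n), ∃ f : UBar K n, m ≠ m₀ →
      evalShift lam hlam (fun i => -(m.count i : ℤ)) f = 0 ∧
        evalShift lam hlam (fun i => -(m₀.count i : ℤ)) f ≠ 0 := fun m => by
    by_cases hm : m = m₀
    · exact ⟨0, fun h => absurd hm h⟩
    · obtain ⟨i, hi⟩ := not_forall.1 (mt Multiset.ext.2 hm)
      -- This factor kills the weight of `m`; at the weight of `m₀` it equals `m.count i - m₀.count
      -- i`, nonzero in characteristic zero.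
      refine ⟨h i - algebraMap K _ (lam i - m.count i), fun _ => ⟨?_, ?_⟩⟩
      · rw [map_sub, evalShift_h, evalShift_scalar]
        push_cast
        ring
      · rw [map_sub, evalShift_h, evalShift_scalar]
        push_cast
        intro h0
        refine hi (Nat.cast_injective (R := K) ?_)
        linear_combination h0
  choose f hf using hsep
  let F : UBar K n := ∏ m ∈ l.support.erase m₀, f m
  have hne : evalShift lam hlam (fun i => -(m₀.count i : ℤ)) F ≠ 0 := by
    rw [map_prod, Finset.prod_ne_zero_iff]
    exact fun m hm => (hf m (Finset.ne_of_mem_erase hm)).2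
  have hmem := N.smul_mem (coeff σ F) hN
  rw [Finsupp.linearCombination_apply, Finsupp.sum, Finset.smul_sum,
    Finset.sum_eq_single_of_mem m₀ (Finsupp.mem_support_iff.2 hl)] at hmem
  · rw [smul_comm, coeff_smul_monomialVec hv, smul_smul, ← algebraMap_smul (Diff σ)] at hmem
    have := N.smul_mem (algebraMap K (Diff σ)
      (l m₀ * evalShift lam hlam (fun i => -(m₀.count i : ℤ)) F)⁻¹) hmem
    rwa [algebraMap_smul, algebraMap_smul, inv_smul_smul₀ (mul_ne_zero hl hne)] at this
  · intro m hm hmne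
    rw [smul_comm, coeff_smul_monomialVec hv, map_prod,
      Finset.prod_eq_zero (Finset.mem_erase.2 ⟨hmne, hm⟩) (hf m hmne).1, zero_smul, smul_zero]

/-- Induction on the degree: a nonzero monomial has each exponent at most `dM i`, so lowering in any
index that occurs has a nonzero factor. -/
theorem highestWeightVector_mem (hv : HasWeight (σ := σ) hlam 0 v) (hx : ∀ i, x σ i • v = 0)
    {dM : Fin n → ℕ} (hdM : ∀ i k, dM i < k → d σ i ^ k • v = 0)
    (hne : ∀ i, ∀ k : ℕ, 1 ≤ k → k ≤ dM i → evalAt lam hlam (σ - shiftAt i (-(k : ℤ)) σ) ≠ 0)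
    (N : Submodule (Diff σ) M) (m : Multiset (Fin n)) (hm : monomialVec σ v m ≠ 0)
    (hN : monomialVec σ v m ∈ N) : v ∈ N := by
  induction hk : m.card generalizing m with
  | zero => rwa [Multiset.card_eq_zero.1 hk, monomialVec_zero] at hN
  | succ k ih =>
    obtain ⟨i, hi⟩ := Multiset.card_pos_iff_exists_mem.1 (by omega : 0 < m.card)
    have hle : m.count i ≤ dM i := by
      by_contra! hlt
      exact hm (monomialVec_eq_zero hv (hdM i _ hlt))
    obtain ⟨c, hc, e⟩ := exists_x_smul_monomialVec hv hx i m
    have hc' := mul_ne_zero hc (hne i _ (Multiset.one_le_count_iff_mem.2 hi) hle)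
    refine ih (m.erase i) (fun h0 => ?_) ?_ (by rw [Multiset.card_erase_of_mem hi, hk]; rfl)
    -- The lowered monomial is nonzero because raising it again gives a multiple of the original
    -- one.
    · obtain ⟨b, hb, eb⟩ := exists_d_smul_monomialVec hv i (m.erase i)
      rw [h0, smul_zero, Multiset.cons_erase hi] at eb
      exact hm ((smul_eq_zero_iff_right hb).1 eb.symm)
    · have := N.smul_mem (algebraMap K (Diff σ)
        (c * evalAt lam hlam (σ - shiftAt i (-(m.count i : ℤ)) σ))⁻¹) (N.smul_mem (x σ i) hN)
      rwa [algebraMap_smul, e, inv_smul_smul₀ hc'] at this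

/-! ### The irreducibility criterion -/

/-- The irreducibility criterion for a module generated by a highest weight vector. -/
theorem isSimpleModule_iff_of_highestWeight [CharZero K] (hn : 0 < n)
    (hv : HasWeight (σ := σ) hlam 0 v)
    (hx : ∀ i, x σ i • v = 0) (hgen : Submodule.span (Diff σ) {v} = ⊤) {dM : Fin n → ℕ}
    (hdM : ∀ i, IsGreatest {k : ℕ | d σ i ^ k • v ≠ 0} (dM i)) :
    IsSimpleModule (Diff σ) M ↔ ∀ i : Fin n,
      evalAt lam hlam (σ - shiftAt i (-((dM i : ℤ) + 1)) σ) = 0 ∧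
        ∀ k : ℕ, 1 ≤ k → k ≤ dM i → evalAt lam hlam (σ - shiftAt i (-(k : ℤ)) σ) ≠ 0 := by
  have hv0 : v ≠ 0 := fun h0 => (hdM ⟨0, hn⟩).1 (by rw [h0, smul_zero])
  have hdM' : ∀ i k, dM i < k → d σ i ^ k • v = 0 := fun i k hk => by
    by_contra hne
    exact (not_le.2 hk) ((hdM i).2 hne)
  refine ⟨fun hM i => ⟨?_, fun k hk hkd h0 => ?_⟩, fun hc => ?_⟩
  -- Apply `x σ i` to the zero vector `d σ i ^ (dM i + 1) • v`; the result is a multiple of a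
  -- nonzero vector.
  · have := x_smul_d_pow_smul hv hx i (dM i + 1)
    rw [hdM' i _ (Nat.lt_succ_self _), smul_zero, Nat.add_sub_cancel, eq_comm, neg_smul,
      neg_eq_zero, smul_eq_zero_iff_left (hdM i).1] at this
    simpa using this
  · have hvk : d σ i ^ k • v ≠ 0 := fun hz => (hdM i).1 (by
      rw [← Nat.sub_add_cancel hkd, pow_add, mul_smul, hz, smul_zero])
    -- Lowering leaves this set only from exponent exactly `k`, where the factor is zero by `h0`.
    let N := monomialSpan hv hx {m | k ≤ m.count i}
      (fun j m hm => le_trans hm (Multiset.count_le_count_cons i j m))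
      (fun j m hm hne => by
        rcases eq_or_ne i j with rfl | hij
        · rw [Set.mem_ofPred_eq, Multiset.count_erase_self]
          have hmk : k ≠ m.count i := fun hmk => hne (hmk ▸ h0)
          have : k ≤ m.count i := hm
          omega
        · rwa [Set.mem_ofPred_eq, Multiset.count_erase_of_ne hij])
    rcases eq_bot_or_eq_top N with hN | hN
    · have hmem : monomialVec σ v (Multiset.replicate k i) ∈ N :=
        mem_monomialSpan.2 (Submodule.subset_span ⟨_, by simp, rfl⟩)
      obtain ⟨c, hc, e⟩ := exists_monomialVec_eq hv i 0 k (m' := Multiset.replicate k i) (by simp)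
      rw [hN, Submodule.mem_bot, e, smul_eq_zero_iff_right hc] at hmem
      exact hvk (by simpa using hmem)
    · have hmem : v ∈ N := hN ▸ Submodule.mem_top
      obtain ⟨l, hl, e⟩ := (Finsupp.mem_span_image_iff_linearCombination K).1
        (mem_monomialSpan.1 hmem)
      have hl0 : l 0 = 0 := by
        by_contra hne
        have : k ≤ (0 : Multiset (Fin n)).count i := hl (Finsupp.mem_support_iff.2 hne)
        rw [Multiset.count_zero] at this
        omega
      -- Subtracting `v` gives a vanishing combination with coefficient `-1` at the empty multiset;
      -- its weight component in `⊥` forces `v = 0`.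
      have := monomialVec_mem_of_linearCombination_mem hv ⊥ (l - Finsupp.single 0 1)
        (by simp [e, monomialVec_zero]) (m₀ := 0) (by simp [hl0])
      rw [monomialVec_zero, Submodule.mem_bot] at this
      exact hv0 this
  · have : Nontrivial M := ⟨⟨v, 0, hv0⟩⟩
    refine { eq_bot_or_eq_top := fun N => or_iff_not_imp_left.2 fun hN => ?_ }
    obtain ⟨u, huN, hu0⟩ := N.ne_bot_iff.1 hN
    have hu : u ∈ Submodule.span K (Set.range (monomialVec σ v)) :=
      span_range_monomialVec hv hx hgen ▸ Submodule.mem_top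
    obtain ⟨l, rfl⟩ := (Finsupp.mem_span_range_iff_exists_finsupp).1 hu
    obtain ⟨m, hm, hne⟩ := Finset.exists_ne_zero_of_sum_ne_zero hu0
    have hmN := monomialVec_mem_of_linearCombination_mem hv N l huN (left_ne_zero_of_smul hne)
    have hvN := highestWeightVector_mem hv hx hdM' (fun i => (hc i).2) N m
      (right_ne_zero_of_smul hne) hmN
    rw [eq_top_iff, ← hgen]
    exact (Submodule.span_singleton_le_iff_mem v N).2 hvN

end HighestWeight

end HDiff

/-! ### Application to quotients of the highest weight module -/

theorem mainTheorem9 {K : Type*} [Field K] [IsAlgClosed K] [CharZero K] {n : ℕ} (hn : 0 < n)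
    (σ : HDiff.UBar K n) (hσ : σ ∈ HDiff.potentials K n)
    (lam : Fin n → K) (hlam : HDiff.Generic lam)
    {M : Type*} [AddCommGroup M] [Module (HDiff.Diff σ) M]
    (q : HDiff.HWModule σ lam →ₗ[HDiff.Diff σ] M) (hq : Function.Surjective q)
    (dM : Fin n → ℕ)
    (hdM : ∀ i, IsGreatest {k : ℕ | HDiff.d σ i ^ k • q (HDiff.hwVector σ lam) ≠ 0} (dM i)) :
    IsSimpleModule (HDiff.Diff σ) M ↔
      ∀ i : Fin n,
        HDiff.evalAt lam hlam (σ - HDiff.shiftAt i (-((dM i : ℤ) + 1)) σ) = 0 ∧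
        ∀ k : ℕ, 1 ≤ k → k ≤ dM i →
          HDiff.evalAt lam hlam (σ - HDiff.shiftAt i (-(k : ℤ)) σ) ≠ 0 := by
  let : Module K M := Module.compHom M (algebraMap K (HDiff.Diff σ))
  have : IsScalarTower K (HDiff.Diff σ) M :=
    ⟨fun c a u => by rw [Algebra.smul_def, mul_smul]; rfl⟩
  have hkill : ∀ a ∈ HDiff.weightIdeal σ lam, a • q (HDiff.hwVector σ lam) = 0 := fun a ha => by
    rw [← map_smul, HDiff.hwVector, ← Submodule.Quotient.mk_smul, smul_eq_mul, mul_one,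
      (Submodule.Quotient.mk_eq_zero _).2 ha, map_zero]
  refine HDiff.isSimpleModule_iff_of_highestWeight hn
    (HDiff.hasWeight_zero_of_h_smul fun i => ?_) (fun i => ?_) ?_ hdM
  · have := hkill _ (Submodule.subset_span (Or.inl ⟨i, rfl⟩))
    rwa [sub_smul, sub_eq_zero, algebraMap_smul] at this
  · exact hkill _ (Submodule.subset_span (Or.inr ⟨i, rfl⟩))
  · refine eq_top_iff.2 fun u _ => ?_
    obtain ⟨w, rfl⟩ := hq u
    obtain ⟨a, rfl⟩ := Submodule.Quotient.mk_surjective _ w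
    rw [Submodule.mem_span_singleton]
    refine ⟨a, ?_⟩
    rw [← map_smul, HDiff.hwVector, ← Submodule.Quotient.mk_smul, smul_eq_mul, mul_one]
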